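/- Let $X$ be a compact metric space with distance $|xy|$, let $\Delta\subset X^2$ be the diagonal, let $\gamma(x,x')=(x',x)$, and let $\mathcal A$ be the algebra of complex-valued Lipschitz functions on $X$. **Spectral geometries.** A spectral geometry on $X$ in a complex Hilbert space $\mathcal H$ consists of a unital $*$-representation $\pi$ of $\mathcal A$ in $\mathcal H$ and an injective compact self-adjoint operator $ds$ on $\mathcal H$ such that: - (i) there is a unital $*$-representation $\widetilde\pi$ of $C(X^2)$ in $\mathcal H$ with $\pi(a)=\widetilde\pi(a\circ \mathrm{pr}_1)$ for all $a\in\mathcal A$; let $P$ be the spectral measure of $\widetilde\pi$, i.e. the projector-valued Borel measure on $X^2$ with $\widetilde\pi(f)=\int_{X^2} f\,dP$ for all $f\in C(X^2)$; - (ii) $ds\circ P(A)=P(\gamma(A))\circ ds$ for every Borel set $A\subset X^2$; - (iii) for every eigenvalue $\lambda$ of $ds$, let $L_\lambda$ be the eigenspace of $ds^2$ for the eigenvalue $\lambda^2$, and let $A_\lambda$ be the union of all open sets $A\subset X^2$ such that the range of $P(A)$ is orthogonal to $L_\lambda$; then $P(A_\lambda)$ is the orthogonal projector onto $L_\lambda^\perp$;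 - (iv) for every eigenvalue $\lambda$ of $ds$, $|yy'|=|\lambda|$ for every $(y,y')\in\Lambda_\lambda:=X^2\setminus A_\lambda$. Its support is $B=\bigcup_\lambda\Lambda_\lambda$, where $\lambda$ runs over all eigenvalues of $ds$. **The model triple.** Let $B\subset X^2\setminus\Delta$ be symmetric ($\gamma(B)=B$) and let $m:B\to\{1,2,3,\dots\}$ satisfy $m(y,y')=m(y',y)$. The model triple $M(B,m)$ consists of the Hilbert space $\mathcal H'$ of all sections $\xi(y,y')\in\mathbb C^{m(y,y')}$, $(y,y')\in B$, with $\|\xi\|^2=\sum_{(y,y')\in B}\|\xi(y,y')\|^2<\infty$, the representation $(\pi'(a)\xi)(y,y')=a(y)\,\xi(y,y')$ of $\mathcal A$, and the operator $(ds'\xi)(y,y')=|yy'|\,\xi(y',y)$. **Theorem.** Let $(\pi,ds)$ be a spectral geometry on $X$ in $\mathcal H$ with support $B$. Then $B\subset X^2\setminus\Delta$, $B$ is symmetric, and $\{(y,y')\in B: |yy'|\ge t\}$ is finite for every $t>0$. Moreover there are a function $m:B\to\{1,2,3,\dots\}$ with $m(y,y')=m(y',y)$ and a surjective linear isometry $U:\mathcal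 H\to\mathcal H'$ onto the Hilbert space of $M(B,m)$ such that $U\pi(a)=\pi'(a)U$ for all $a\in\mathcal A$ and $U\,ds=ds'\,U$. -/

import Mathlib

noncomputable section

open MeasureTheory Filter Topology

/-- A spectral measure on `T` in the Hilbert space `H`: every Borel set `A` is assigned an
orthogonal projector `proj A`, and for each vector `ξ` the function `A ↦ ⟨proj A ξ, ξ⟩` is a Borel
measure, called `scalar ξ`. The values of `proj` on nonmeasurable sets play no role. -/
structure SpectralMeasure (T : Type*) [MeasurableSpace T] (H : Type*)
    [NormedAddCommGroup H] [InnerProductSpace ℂ H] [CompleteSpace H] where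
  proj : Set T → H →L[ℂ] H
  isStarProjection_proj : ∀ A, MeasurableSet A → IsStarProjection (proj A)
  scalar : H → Measure T
  scalar_apply : ∀ ξ A, MeasurableSet A →
    scalar ξ A = ENNReal.ofReal (inner ℂ ξ (proj A ξ)).re

namespace SpectralMeasure

variable {T : Type*} [MeasurableSpace T] {H : Type*}
    [NormedAddCommGroup H] [InnerProductSpace ℂ H] [CompleteSpace H]

/-- `ρ f = ∫ f dP` for every continuous `f`. This operator integral is determined by its quadratic
form, `⟨(∫ f dP) ξ, ξ⟩ = ∫ f d⟨P ξ, ξ⟩`. -/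
def Represents [TopologicalSpace T] (P : SpectralMeasure T H)
    (ρ : C(T, ℂ) →⋆ₐ[ℂ] (H →L[ℂ] H)) : Prop :=
  ∀ (f : C(T, ℂ)) (ξ : H), inner ℂ ξ (ρ f ξ) = ∫ z, f z ∂(P.scalar ξ)

end SpectralMeasure

theorem inner_rep_self {T : Type*} [TopologicalSpace T] {H : Type*} [NormedAddCommGroup H]
    [InnerProductSpace ℂ H] [CompleteSpace H] (ρ : C(T, ℂ) →⋆ₐ[ℂ] (H →L[ℂ] H)) (f g : C(T, ℂ)) (ξ η : H) :
    inner ℂ (ρ f ξ) (ρ g η) = inner ℂ ξ (ρ (star f * g) η) := by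
  rw [map_mul, map_star, ContinuousLinearMap.star_eq_adjoint, mul_apply_eq_comp,
    ContinuousLinearMap.adjoint_inner_right]

theorem isStarProjection_of_inner {H : Type*} [NormedAddCommGroup H] [InnerProductSpace ℂ H]
    [CompleteSpace H] (Q : H →L[ℂ] H)
    (hQ : ∀ ξ, inner ℂ ξ (Q ξ) = inner ℂ (Q ξ) (Q ξ)) : IsStarProjection Q := by
  have h1 : star Q * Q = Q := by
    apply ContinuousLinearMap.coe_injective
    rw [← ext_inner_map]
    intro ξ
    rw [ContinuousLinearMap.coe_coe, ContinuousLinearMap.coe_coe,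
      ContinuousLinearMap.star_eq_adjoint]
    change inner ℂ (ContinuousLinearMap.adjoint Q (Q ξ)) ξ = _
    rw [ContinuousLinearMap.adjoint_inner_left, ← hQ ξ, ← inner_conj_symm (Q ξ) ξ, hQ ξ,
      inner_self_conj]
  have h2 : IsSelfAdjoint Q := by
    rw [← h1]; exact IsSelfAdjoint.star_mul_self Q
  refine ⟨?_, h2⟩
  rw [h2.star_eq] at h1
  exact h1

section Existence

variable {T : Type*} [MetricSpace T] [CompactSpace T] [MeasurableSpace T] [BorelSpace T]
  {H : Type*} [NormedAddCommGroup H] [InnerProductSpace ℂ H] [CompleteSpace H]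

theorem exists_scalar_measure (ρ : C(T, ℂ) →⋆ₐ[ℂ] (H →L[ℂ] H)) (ξ : H) :
    ∃ μ : Measure T, IsFiniteMeasure μ ∧
      ∀ f : C(T, ℂ), inner ℂ ξ (ρ f ξ) = ∫ z, f z ∂μ := by
  let c : C(T, ℝ) → C(T, ℂ) := fun g => ⟨fun z => (g z : ℂ), by fun_prop⟩
  have hsq : ∀ g : C(T, ℝ), 0 ≤ g → 0 ≤ (inner ℂ ξ (ρ (c g) ξ)).re := by
    intro g hg
    let s : C(T, ℝ) := ⟨fun z => Real.sqrt (g z), by fun_prop⟩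
    have h1 : c g = star (c s) * c s := by
      ext z
      simp only [c, s, ContinuousMap.coe_mk, ContinuousMap.mul_apply, ContinuousMap.star_apply,
        Complex.star_def, Complex.conj_ofReal]
      rw [← Complex.ofReal_mul]
      exact congrArg _ (Real.mul_self_sqrt (hg z)).symm
    rw [h1, ← inner_rep_self]
    exact inner_self_nonneg (𝕜 := ℂ)
  let Λ : CompactlySupportedContinuousMap T ℝ →ₚ[ℝ] ℝ := PositiveLinearMap.mk₀
    { toFun := fun g => (inner ℂ ξ (ρ (c g.toContinuousMap) ξ)).re
      map_add' := by
        intro f g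
        have : c (f + g).toContinuousMap = c f.toContinuousMap + c g.toContinuousMap := by
          ext z; simp [c]
        rw [this, map_add, add_apply, inner_add_right, Complex.add_re]
      map_smul' := by
        intro r g
        have : c (r • g).toContinuousMap = (r : ℂ) • c g.toContinuousMap := by
          ext z; simp [c]
        rw [this, map_smul, smul_apply, inner_smul_right, Complex.re_ofReal_mul]
        rfl }
    (fun g hg => hsq _ hg)
  refine ⟨RealRMK.rieszMeasure Λ, inferInstance, ?_⟩
  have hreal : ∀ g : C(T, ℝ), inner ℂ ξ (ρ (c g) ξ) =
      ((∫ z, g z ∂(RealRMK.rieszMeasure Λ) : ℝ) : ℂ) := by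
    intro g
    have h1 := RealRMK.integral_rieszMeasure Λ (CompactlySupportedContinuousMap.continuousMapEquiv g)
    have h2 : Λ (CompactlySupportedContinuousMap.continuousMapEquiv g)
        = (inner ℂ ξ (ρ (c g) ξ)).re := rfl
    have h3 : ∫ z, g z ∂(RealRMK.rieszMeasure Λ) = (inner ℂ ξ (ρ (c g) ξ)).re := h1.trans h2
    rw [h3]
    have hsa : star (c g) = c g := by ext z; simp [c]
    have h4 : (starRingEnd ℂ) (inner ℂ ξ (ρ (c g) ξ)) = inner ℂ ξ (ρ (c g) ξ) := by
      rw [inner_conj_symm]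
      have := inner_rep_self ρ (c g) 1 ξ ξ
      rw [hsa, mul_one, map_one, one_apply_eq_self] at this
      exact this
    exact (Complex.conj_eq_iff_re.mp h4).symm
  intro f
  let u : C(T, ℝ) := ⟨fun z => (f z).re, by fun_prop⟩
  let v : C(T, ℝ) := ⟨fun z => (f z).im, by fun_prop⟩
  have hf : f = c u + Complex.I • c v := by
    ext z
    simp [c, u, v, mul_comm Complex.I, Complex.re_add_im]
  have hint : ∀ g : C(T, ℝ), Integrable (fun z => ((g z : ℝ) : ℂ)) (RealRMK.rieszMeasure Λ) :=
    fun g => (c g).continuous.integrable_of_hasCompactSupport (HasCompactSupport.of_compactSpace _)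
  have hfz : ∀ z, f z = (u z : ℂ) + Complex.I * (v z : ℂ) := by
    intro z; simp [u, v, mul_comm Complex.I, Complex.re_add_im]
  simp_rw [hfz]
  rw [integral_add (hint u) ((hint v).const_mul _), integral_const_mul, integral_complex_ofReal,
    integral_complex_ofReal, ← hreal, ← hreal]
  conv_lhs => rw [hf]
  rw [map_add, map_smul, add_apply, smul_apply,
    inner_add_right, inner_smul_right]

theorem exists_continuous_approx (μ : Measure T) [IsFiniteMeasure μ] {A : Set T}
    (hA : MeasurableSet A) {ε : ENNReal} (hε : ε ≠ 0) :
    ∃ f : C(T, ℂ), eLpNorm (A.indicator (fun _ => (1 : ℂ)) - ⇑f) 2 μ ≤ ε := by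
  have hm : MemLp (A.indicator (fun _ => (1 : ℂ))) 2 μ := (memLp_const (1 : ℂ)).indicator hA
  obtain ⟨g, hg, -⟩ := hm.exists_boundedContinuous_eLpNorm_sub_le (by norm_num) hε
  exact ⟨g.toContinuousMap, hg⟩

theorem exists_proj_vector (ρ : C(T, ℂ) →⋆ₐ[ℂ] (H →L[ℂ] H)) (ξ : H) (μ : Measure T)
    [IsFiniteMeasure μ] (hμ : ∀ f : C(T, ℂ), inner ℂ ξ (ρ f ξ) = ∫ z, f z ∂μ)
    {A : Set T} (hA : MeasurableSet A) :
    ∃ v : H, (∀ f : C(T, ℂ),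
        ‖v - ρ f ξ‖ₑ = eLpNorm (A.indicator (fun _ => (1 : ℂ)) - ⇑f) 2 μ) ∧
      inner ℂ ξ v = μ.real A ∧ inner ℂ v v = μ.real A := by
  let e : C(T, ℂ) →ₗ[ℂ] Lp ℂ 2 μ := (ContinuousMap.toLp 2 μ ℂ : C(T, ℂ) →L[ℂ] Lp ℂ 2 μ)
  have he : DenseRange e := ContinuousMap.toLp_denseRange ℂ μ ℂ (by norm_num)
  let r : C(T, ℂ) →ₗ[ℂ] H :=
    { toFun := fun f => ρ f ξ
      map_add' := fun f g => by rw [map_add]; rfl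
      map_smul' := fun c g => by rw [map_smul]; rfl }
  have hin : ∀ f g, inner ℂ (r f) (r g) = inner ℂ (e f) (e g) := by
    intro f g
    change inner ℂ (ρ f ξ) (ρ g ξ) = inner ℂ (ContinuousMap.toLp 2 μ ℂ f)
      (ContinuousMap.toLp 2 μ ℂ g)
    rw [inner_rep_self, hμ, ContinuousMap.inner_toLp]
    refine integral_congr_ae (Eventually.of_forall fun z => ?_)
    simp [mul_comm]
  have hno : ∀ f, ‖r f‖ = ‖e f‖ := by
    intro f
    rw [@norm_eq_sqrt_re_inner ℂ, @norm_eq_sqrt_re_inner ℂ _ _ _ _ (e f), hin]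
  have hno' : ∀ f, ‖r f‖ ≤ 1 * ‖e f‖ := fun f => by rw [one_mul, hno]
  let V : Lp ℂ 2 μ →L[ℂ] H := r.extendOfNorm e
  have hV : ∀ f, V (e f) = r f := fun f => LinearMap.extendOfNorm_eq he ⟨1, hno'⟩ f
  have hVn : ∀ x, ‖V x‖ = ‖x‖ := by
    refine he.induction ?_ (isClosed_eq (by fun_prop) (by fun_prop))
    rintro _ ⟨f, rfl⟩
    rw [hV, hno]
  let W : Lp ℂ 2 μ →ₗᵢ[ℂ] H := ⟨V.toLinearMap, hVn⟩
  have hW : ∀ f, W (e f) = ρ f ξ := hV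
  let a : Lp ℂ 2 μ := indicatorConstLp 2 hA (measure_ne_top μ A) 1
  have h1 : W (e 1) = ξ := by rw [hW, map_one]; rfl
  have he1 : (e 1 : Lp ℂ 2 μ) = indicatorConstLp 2 MeasurableSet.univ (measure_ne_top μ _) 1 := by
    apply Lp.ext
    refine (ContinuousMap.coeFn_toLp μ (𝕜 := ℂ) (1 : C(T, ℂ))).trans ?_
    refine EventuallyEq.trans ?_ indicatorConstLp_coeFn.symm
    simp only [Set.indicator_univ]
    rfl
  have haI : ∀ {s : Set T}, MeasurableSet s → ∫ x in s, a x ∂μ = ((μ.real (A ∩ s) : ℝ) : ℂ) := by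
    intro s hs
    have : ∫ x in s, a x ∂μ = ∫ x in s, A.indicator (fun _ => (1 : ℂ)) x ∂μ :=
      integral_congr_ae (ae_restrict_of_ae indicatorConstLp_coeFn)
    rw [this, integral_indicator hA, Measure.restrict_restrict hA, setIntegral_const]
    simp
  refine ⟨W a, fun f => ?_, ?_, ?_⟩
  · rw [← hW, ← map_sub, LinearIsometry.enorm_map, Lp.enorm_def]
    refine eLpNorm_congr_ae ((Lp.coeFn_sub _ _).trans ?_)
    exact indicatorConstLp_coeFn.sub (ContinuousMap.coeFn_toLp μ (𝕜 := ℂ) f)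
  · conv_lhs => rw [← h1]
    rw [LinearIsometry.inner_map_map, he1, L2.inner_indicatorConstLp_one, haI MeasurableSet.univ,
      Set.inter_univ]
  · rw [LinearIsometry.inner_map_map]
    change inner ℂ (indicatorConstLp 2 hA (measure_ne_top μ A) (1 : ℂ)) a = _
    rw [L2.inner_indicatorConstLp_one, haI hA, Set.inter_self]

theorem exists_spectralMeasure (ρ : C(T, ℂ) →⋆ₐ[ℂ] (H →L[ℂ] H)) :
    ∃ P : SpectralMeasure T H, P.Represents ρ := by
  classical
  choose μ hfin hμ using exists_scalar_measure ρ
  have key : ∀ A : Set T, MeasurableSet A → ∃ Q : H →L[ℂ] H,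
      ∀ ξ, inner ℂ ξ (Q ξ) = (μ ξ).real A ∧ inner ℂ (Q ξ) (Q ξ) = (μ ξ).real A := by
    intro A hA
    choose v hv hv1 hv2 using fun ξ => exists_proj_vector ρ ξ (μ ξ) (hμ ξ) hA
    have hzero : ∀ w : H, (∀ ε : ENNReal, ε ≠ 0 → ‖w‖ₑ ≤ 3 * ε) → w = 0 := by
      intro w hw
      by_contra hne
      have h0 : ‖w‖ₑ ≠ 0 := by simpa using hne
      have h1 := hw (‖w‖ₑ / 4) (by simp [h0])
      have h2 : ‖w‖ = ‖w‖ₑ.toReal := by simp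
      have h3 : ‖w‖ ≤ 3 * (‖w‖ / 4) := by
        have := ENNReal.toReal_mono (by finiteness) h1
        simpa using this
      have : 0 < ‖w‖ := norm_pos_iff.mpr hne
      linarith
    have hle : ∀ (ξ : H) (ν : Measure T) (f : C(T, ℂ)), μ ξ ≤ ν →
        ‖v ξ - ρ f ξ‖ₑ ≤ eLpNorm (A.indicator (fun _ => (1 : ℂ)) - ⇑f) 2 ν := by
      intro ξ ν f hν
      rw [hv]
      exact eLpNorm_mono_measure _ hν
    have hadd : ∀ ξ η, v (ξ + η) = v ξ + v η := by
      intro ξ η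
      rw [← sub_eq_zero]
      apply hzero
      intro ε hε
      obtain ⟨f, hf⟩ := exists_continuous_approx (μ (ξ + η) + (μ ξ + μ η)) hA hε
      have e1 := (hle (ξ + η) _ f (Measure.le_add_right le_rfl)).trans hf
      have e2 := (hle ξ _ f (Measure.le_add_left (Measure.le_add_right le_rfl))).trans hf
      have e3 := (hle η _ f (Measure.le_add_left (Measure.le_add_left le_rfl))).trans hf
      have hdec : v (ξ + η) - (v ξ + v η) =
          (v (ξ + η) - ρ f (ξ + η)) - (v ξ - ρ f ξ) - (v η - ρ f η) := by
        rw [map_add]; abel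
      rw [hdec]
      calc _ ≤ ‖v (ξ + η) - ρ f (ξ + η)‖ₑ + ‖v ξ - ρ f ξ‖ₑ + ‖v η - ρ f η‖ₑ :=
            (enorm_sub_le).trans (by gcongr; exact enorm_sub_le)
        _ ≤ ε + ε + ε := by gcongr
        _ = 3 * ε := by ring
    have hsmul : ∀ (c : ℂ) ξ, v (c • ξ) = c • v ξ := by
      intro c ξ
      rw [← sub_eq_zero]
      by_contra hne
      have h0 : ‖v (c • ξ) - c • v ξ‖ₑ ≠ 0 := by simpa using hne
      have hb : ∀ ε : ENNReal, ε ≠ 0 → ‖v (c • ξ) - c • v ξ‖ₑ ≤ ε + ‖c‖ₑ * ε := by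
        intro ε hε
        obtain ⟨f, hf⟩ := exists_continuous_approx (μ (c • ξ) + μ ξ) hA hε
        have e1 := (hle (c • ξ) _ f (Measure.le_add_right le_rfl)).trans hf
        have e2 := (hle ξ _ f (Measure.le_add_left le_rfl)).trans hf
        have hdec : v (c • ξ) - c • v ξ = (v (c • ξ) - ρ f (c • ξ)) - c • (v ξ - ρ f ξ) := by
          rw [map_smul, smul_sub]; abel
        rw [hdec]
        calc _ ≤ ‖v (c • ξ) - ρ f (c • ξ)‖ₑ + ‖c • (v ξ - ρ f ξ)‖ₑ := enorm_sub_le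
          _ ≤ ε + ‖c‖ₑ * ε := by rw [enorm_smul]; gcongr
      have hpos : 0 < ‖v (c • ξ) - c • v ξ‖ := norm_pos_iff.mpr hne
      have hc : 0 < 1 + ‖c‖ := by positivity
      have h1 := hb (ENNReal.ofReal (‖v (c • ξ) - c • v ξ‖ / (2 * (1 + ‖c‖))))
        (by simp only [ne_eq, ENNReal.ofReal_eq_zero, not_le]; positivity)
      have h2 := ENNReal.toReal_mono (by finiteness) h1
      rw [ENNReal.toReal_add (by finiteness) (by finiteness), ENNReal.toReal_mul,
        ENNReal.toReal_ofReal (by positivity), toReal_enorm, toReal_enorm] at h2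
      have h3 : ‖v (c • ξ) - c • v ξ‖ / (2 * (1 + ‖c‖)) +
          ‖c‖ * (‖v (c • ξ) - c • v ξ‖ / (2 * (1 + ‖c‖))) = ‖v (c • ξ) - c • v ξ‖ / 2 := by
        field_simp
      linarith
    have hbd : ∀ ξ, ‖v ξ‖ ≤ 1 * ‖ξ‖ := by
      intro ξ
      have h1 : inner ℂ ξ (v ξ) = inner ℂ (v ξ) (v ξ) := (hv1 ξ).trans (hv2 ξ).symm
      have h2 : ‖v ξ‖ * ‖v ξ‖ ≤ ‖ξ‖ * ‖v ξ‖ := by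
        have := norm_inner_le_norm (𝕜 := ℂ) ξ (v ξ)
        rw [h1] at this
        rw [inner_self_eq_norm_sq_to_K, norm_pow] at this
        simpa [sq] using this
      rcases (norm_nonneg (v ξ)).eq_or_lt with h | h
      · rw [← h]; positivity
      · rw [one_mul]; exact le_of_mul_le_mul_right h2 h
    exact ⟨LinearMap.mkContinuous ⟨⟨v, hadd⟩, hsmul⟩ 1 hbd, fun ξ => ⟨hv1 ξ, hv2 ξ⟩⟩
  choose! Q hQ using key
  refine ⟨⟨Q, fun A hA => isStarProjection_of_inner _ fun ξ =>
    ((hQ A hA ξ).1.trans (hQ A hA ξ).2.symm), μ, fun ξ A hA => ?_⟩, fun f ξ => hμ ξ f⟩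
  rw [(hQ A hA ξ).1, Complex.ofReal_re, ofReal_measureReal]

/-- The spectral measure of a representation is unique. -/
theorem SpectralMeasure.Represents.proj_eq {ρ : C(T, ℂ) →⋆ₐ[ℂ] (H →L[ℂ] H)}
    {P Q : SpectralMeasure T H} (hP : P.Represents ρ) (hQ : Q.Represents ρ) {A : Set T}
    (hA : MeasurableSet A) : P.proj A = Q.proj A := by
  have hfin : ∀ (R : SpectralMeasure T H) ξ, IsFiniteMeasure (R.scalar ξ) := by
    intro R ξ
    exact ⟨by rw [R.scalar_apply ξ _ MeasurableSet.univ]; exact ENNReal.ofReal_lt_top⟩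
  have hstar : ∀ (R : SpectralMeasure T H) ξ,
      inner ℂ (R.proj A ξ) ξ = (((R.scalar ξ).real A : ℝ) : ℂ) := by
    intro R ξ
    have h := R.isStarProjection_proj A hA
    have h1 : inner ℂ (R.proj A ξ) ξ = inner ℂ (R.proj A ξ) (R.proj A ξ) := by
      have h2 : R.proj A (R.proj A ξ) = R.proj A ξ :=
        congrArg (fun S : H →L[ℂ] H => S ξ) h.isIdempotentElem
      conv_lhs => rw [← h2]
      exact h.isSelfAdjoint.isSymmetric (R.proj A ξ) ξ
    have h3 : inner ℂ ξ (R.proj A ξ) = inner ℂ (R.proj A ξ) (R.proj A ξ) := by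
      rw [← inner_conj_symm, h1, inner_self_conj]
    rw [Measure.real, R.scalar_apply ξ A hA, h1, h3, inner_self_eq_norm_sq_to_K]
    change (‖R.proj A ξ‖ : ℂ) ^ 2 = _
    rw [← Complex.ofReal_pow]
    change _ = ((ENNReal.ofReal (((‖R.proj A ξ‖ : ℂ) ^ 2).re)).toReal : ℂ)
    rw [← Complex.ofReal_pow, Complex.ofReal_re, ENNReal.toReal_ofReal (by positivity)]
  apply ContinuousLinearMap.coe_injective
  rw [← ext_inner_map]
  intro ξ
  change inner ℂ (P.proj A ξ) ξ = inner ℂ (Q.proj A ξ) ξ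
  have := hfin P ξ
  have := hfin Q ξ
  have hPQ : P.scalar ξ = Q.scalar ξ := by
    refine ext_of_forall_integral_eq_of_IsFiniteMeasure fun f => ?_
    let g : C(T, ℂ) := ⟨fun z => (f z : ℂ), by fun_prop⟩
    have h := (hP g ξ).symm.trans (hQ g ξ)
    have h1 : ∀ μ : Measure T, ∫ z, g z ∂μ = ((∫ z, f z ∂μ : ℝ) : ℂ) :=
      fun μ => integral_complex_ofReal
    rw [h1, h1] at h
    exact_mod_cast h
  rw [hstar, hstar, hPQ]

/-- The spectral measure `P` of a representation `ρ` of `C(T)`: `ρ f = ∫ f dP` for all `f`. -/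
def spectralMeasure (ρ : C(T, ℂ) →⋆ₐ[ℂ] (H →L[ℂ] H)) : SpectralMeasure T H :=
  (exists_spectralMeasure ρ).choose

theorem spectralMeasure_represents (ρ : C(T, ℂ) →⋆ₐ[ℂ] (H →L[ℂ] H)) :
    (spectralMeasure ρ).Represents ρ :=
  (exists_spectralMeasure ρ).choose_spec

end Existence

section Geometry

variable (X : Type*) [MetricSpace X] [CompactSpace X]

/-- The algebra of complex-valued Lipschitz functions on `X`, inside `C(X)`. -/
def lipschitzAlgebra : StarSubalgebra ℂ C(X, ℂ) where
  carrier := {f | ∃ K : NNReal, LipschitzWith K f}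
  mul_mem' := by
    rintro f g ⟨K, hK⟩ ⟨L, hL⟩
    refine ⟨‖f‖₊ * L + ‖g‖₊ * K, LipschitzWith.of_dist_le_mul fun x y => ?_⟩
    have h1 : (f * g) x - (f * g) y = f x * (g x - g y) + g y * (f x - f y) := by
      simp only [ContinuousMap.mul_apply]; ring
    have hf := hK.dist_le_mul x y
    have hg := hL.dist_le_mul x y
    rw [dist_eq_norm] at hf hg
    rw [dist_eq_norm, h1]
    calc _ ≤ ‖f x‖ * ‖g x - g y‖ + ‖g y‖ * ‖f x - f y‖ := by
          refine (norm_add_le _ _).trans ?_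
          rw [norm_mul, norm_mul]
      _ ≤ ‖f‖ * (L * dist x y) + ‖g‖ * (K * dist x y) := by
          gcongr
          · exact f.norm_coe_le_norm x
          · exact g.norm_coe_le_norm y
      _ = _ := by push_cast; ring
  add_mem' := by
    rintro f g ⟨K, hK⟩ ⟨L, hL⟩
    exact ⟨K + L, hK.add hL⟩
  algebraMap_mem' := fun c => ⟨0, LipschitzWith.const c⟩
  star_mem' := by
    rintro f ⟨K, hK⟩
    refine ⟨K, LipschitzWith.of_dist_le_mul fun x y => ?_⟩
    have : dist ((star f) x) ((star f) y) = dist (f x) (f y) := by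
      simp only [ContinuousMap.star_apply, dist_star_star]
    rw [this]
    exact hK.dist_le_mul x y

variable {X} in
/-- A function `a` on `X` considered as the function `(x, x') ↦ a x` on `X × X`. -/
def liftFst (a : C(X, ℂ)) : C(X × X, ℂ) := a.comp ContinuousMap.fst

variable {H : Type*} [NormedAddCommGroup H] [InnerProductSpace ℂ H] [CompleteSpace H]

/-- The eigenspace `L_l` of `T ^ 2` for the value `l ^ 2`. -/
def sqEigenspace (T : H →L[ℂ] H) (l : ℂ) : Submodule ℂ H :=
  Module.End.eigenspace ((T ∘L T : H →L[ℂ] H) : H →ₗ[ℂ] H) (l ^ 2)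

variable {X} in
/-- The union `A_l` of all open `A ⊆ X × X` such that `P A` is a projector on a subspace orthogonal
to the eigenspace `L_l` of `T ^ 2`. -/
def orthogonalOpen [MeasurableSpace X] (P : SpectralMeasure (X × X) H) (T : H →L[ℂ] H) (l : ℂ) :
    Set (X × X) :=
  ⋃₀ {A | IsOpen A ∧ LinearMap.range (P.proj A : H →ₗ[ℂ] H) ≤ (sqEigenspace T l)ᗮ}

/-- A spectral geometry on the compact metric space `X` in the Hilbert space `H`. -/
structure SpectralGeometry (X : Type*) [MetricSpace X] [CompactSpace X] [MeasurableSpace X]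
    [BorelSpace X] (H : Type*) [NormedAddCommGroup H] [InnerProductSpace ℂ H]
    [CompleteSpace H] where
  /-- The involutive representation `π` of the algebra of Lipschitz functions. -/
  rep : lipschitzAlgebra X →⋆ₐ[ℂ] (H →L[ℂ] H)
  /-- The unit length operator. -/
  ds : H →L[ℂ] H
  ds_injective : Function.Injective ds
  ds_compact : IsCompactOperator ds
  ds_selfAdjoint : IsSelfAdjoint ds
  /-- `π` is the restriction of an involutive representation of `C(X × X)`. -/
  repExt : C(X × X, ℂ) →⋆ₐ[ℂ] (H →L[ℂ] H)
  rep_eq : ∀ a : lipschitzAlgebra X, rep a = repExt (liftFst (a : C(X, ℂ)))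
  /-- `ds` intertwines the spectral measure with its reflection. -/
  ds_comp_proj : ∀ A : Set (X × X), MeasurableSet A →
    ds ∘L (spectralMeasure repExt).proj A = (spectralMeasure repExt).proj (Prod.swap '' A) ∘L ds
  /-- `P (A_l)` is the projector onto the orthogonal complement of `L_l`. -/
  proj_orthogonalOpen : ∀ l : ℂ, Module.End.HasEigenvalue (ds : H →ₗ[ℂ] H) l →
    (spectralMeasure repExt).proj (orthogonalOpen (spectralMeasure repExt) ds l) =
      (sqEigenspace ds l)ᗮ.starProjection
  /-- Distances between the components of points outside `A_l` equal `|l|`. -/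
  dist_eq : ∀ l : ℂ, Module.End.HasEigenvalue (ds : H →ₗ[ℂ] H) l →
    ∀ z ∈ (orthogonalOpen (spectralMeasure repExt) ds l)ᶜ, dist z.1 z.2 = ‖l‖

variable {X} in
/-- The support of a spectral geometry: the union over all eigenvalues `l` of `ds` of the
complements of the sets `A_l`. -/
def SpectralGeometry.support [MeasurableSpace X] [BorelSpace X] (M : SpectralGeometry X H) :
    Set (X × X) :=
  ⋃ (l : ℂ) (_ : Module.End.HasEigenvalue (M.ds : H →ₗ[ℂ] H) l),
    (orthogonalOpen (spectralMeasure M.repExt) M.ds l)ᶜ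

end Geometry

section Model

theorem summable_comp_bound {ι : Type*} {E : ι → Type*} [∀ i, NormedAddCommGroup (E i)]
    {σ : ι → ι} (hσ : Function.Injective σ) (C : ℝ) (ξ : lp E 2) :
    Summable (fun i => (C * ‖ξ (σ i)‖) ^ 2) ∧
      ∑' i, (C * ‖ξ (σ i)‖) ^ 2 ≤ (C * ‖ξ‖) ^ 2 := by
  have h := lp.hasSum_norm (p := 2) (by norm_num) ξ
  simp only [ENNReal.toReal_ofNat, Real.rpow_ofNat] at h
  simp only [mul_pow]
  refine ⟨(h.summable.comp_injective hσ).mul_left _, ?_⟩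
  rw [tsum_mul_left, ← h.tsum_eq]
  exact mul_le_mul_of_nonneg_left
    (tsum_comp_le_tsum_of_inj h.summable (fun i => by positivity) hσ) (by positivity)

/-- The bounded operator `(S ξ) i = L i (ξ (σ i))` on a Hilbert sum, for an injective map `σ` of
the index set and uniformly bounded linear maps `L i` between the fibres. -/
def weightedShift {ι : Type*} {E : ι → Type*} [∀ i, NormedAddCommGroup (E i)]
    [∀ i, InnerProductSpace ℂ (E i)] (σ : ι → ι) (hσ : Function.Injective σ)
    (L : ∀ i, E (σ i) →ₗ[ℂ] E i) (hL : ∃ C : ℝ, ∀ i x, ‖L i x‖ ≤ C * ‖x‖) :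
    lp E 2 →L[ℂ] lp E 2 :=
  LinearMap.mkContinuousOfExistsBound
    { toFun := fun ξ => ⟨fun i => L i (ξ (σ i)), by
        obtain ⟨C, hC⟩ := hL
        refine memℓp_gen ?_
        simp only [ENNReal.toReal_ofNat, Real.rpow_ofNat]
        refine (summable_comp_bound hσ C ξ).1.of_nonneg_of_le (fun i => by positivity) fun i => ?_
        gcongr
        exact hC i _⟩
      map_add' := fun ξ η => by ext1; funext i; simp; rfl
      map_smul' := fun c ξ => by ext1; funext i; simp }
    (by
      obtain ⟨C, hC⟩ := hL
      refine ⟨|C|, fun ξ => ?_⟩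
      have hb := summable_comp_bound hσ |C| ξ
      refine lp.norm_le_of_tsum_le (p := 2) (by norm_num) (by positivity) ?_
      simp only [ENNReal.toReal_ofNat, Real.rpow_ofNat]
      have hle : ∀ i, ‖L i (ξ (σ i))‖ ^ 2 ≤ (|C| * ‖ξ (σ i)‖) ^ 2 := by
        intro i
        gcongr
        exact (hC i _).trans (by gcongr; exact le_abs_self C)
      exact ((hb.1.of_nonneg_of_le (fun i => by positivity) hle).tsum_le_tsum hle hb.1).trans hb.2)

@[simp]
theorem weightedShift_apply {ι : Type*} {E : ι → Type*} [∀ i, NormedAddCommGroup (E i)]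
    [∀ i, InnerProductSpace ℂ (E i)] (σ : ι → ι) (hσ : Function.Injective σ)
    (L : ∀ i, E (σ i) →ₗ[ℂ] E i) (hL : ∃ C : ℝ, ∀ i x, ‖L i x‖ ≤ C * ‖x‖) (ξ : lp E 2) (i : ι) :
    weightedShift σ hσ L hL ξ i = L i (ξ (σ i)) :=
  rfl

variable {X : Type*} [MetricSpace X] [CompactSpace X] {B : Set (X × X)}

/-- The Hilbert space of square summable sections of the bundle over `B` whose fibre over
`b` is `ℂ ^ (m b)`. -/
abbrev ModelSpace (m : B → ℕ) : Type _ :=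
  lp (fun b : B => EuclideanSpace ℂ (Fin (m b))) 2

/-- The multiplication operator `(a ξ) (y, y') = a y • ξ (y, y')`. -/
def modelMul (m : B → ℕ) (a : C(X, ℂ)) : ModelSpace m →L[ℂ] ModelSpace m :=
  weightedShift id Function.injective_id (fun b => a b.1.1 • LinearMap.id)
    ⟨‖a‖, fun b x => by
      simp only [LinearMap.smul_apply, LinearMap.id_apply, id, norm_smul]
      gcongr
      exact a.norm_coe_le_norm _⟩

theorem modelMul_apply (m : B → ℕ) (a : C(X, ℂ)) (ξ : ModelSpace m) (b : B) :
    modelMul m a ξ b = a b.1.1 • ξ b :=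
  rfl

/-- The representation of the Lipschitz functions by multiplication operators. -/
def modelRep (m : B → ℕ) : lipschitzAlgebra X →⋆ₐ[ℂ] (ModelSpace m →L[ℂ] ModelSpace m) where
  toFun a := modelMul m a
  map_one' := by
    ext1 ξ; ext1; funext b; simp [modelMul_apply]
  map_mul' a a' := by
    ext1 ξ; ext1; funext b; simp [modelMul_apply, mul_smul]
  map_zero' := by
    ext1 ξ; ext1; funext b; simp [modelMul_apply]
  map_add' a a' := by
    ext1 ξ; ext1; funext b; simp [modelMul_apply, add_smul]
  commutes' c := by
    ext1 ξ; ext1; funext b; simp [modelMul_apply, Algebra.algebraMap_eq_smul_one]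
  map_star' a := by
    rw [ContinuousLinearMap.star_eq_adjoint, ContinuousLinearMap.eq_adjoint_iff]
    intro ξ η
    rw [lp.inner_eq_tsum, lp.inner_eq_tsum]
    refine tsum_congr fun b => ?_
    rw [modelMul_apply, modelMul_apply, inner_smul_left, inner_smul_right]
    simp

/-- The reflection `(y, y') ↦ (y', y)` of a symmetric set `B`. -/
def swapPoint (hB : ∀ z ∈ B, z.swap ∈ B) (b : B) : B := ⟨b.1.swap, hB b.1 b.2⟩

/-- The unit length operator `(ds ξ) (y, y') = |y y'| • ξ (y', y)` for a symmetric set `B` and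
a symmetric multiplicity `m`, where the fibres `ℂ ^ m (y', y)` and `ℂ ^ m (y, y')` are
identified coordinatewise. -/
def modelDs (hB : ∀ z ∈ B, z.swap ∈ B) (m : B → ℕ) (hm : ∀ b, m (swapPoint hB b) = m b) :
    ModelSpace m →L[ℂ] ModelSpace m :=
  weightedShift (swapPoint hB)
    (fun b c h => Subtype.ext (Prod.swap_injective (congrArg Subtype.val h)))
    (fun b => (dist b.1.1 b.1.2 : ℂ) •
      (LinearIsometryEquiv.piLpCongrLeft 2 ℂ ℂ (finCongr (hm b))).toLinearEquiv.toLinearMap)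
    ⟨Metric.diam (Set.univ : Set X), fun b x => by
      rw [LinearMap.smul_apply, norm_smul, Complex.norm_real, Real.norm_of_nonneg dist_nonneg]
      have h : ‖(LinearIsometryEquiv.piLpCongrLeft 2 ℂ ℂ (finCongr (hm b))) x‖ = ‖x‖ :=
        LinearIsometryEquiv.norm_map _ x
      refine le_of_eq_of_le (congrArg _ h) ?_
      gcongr
      exact Metric.dist_le_diam_of_mem isCompact_univ.isBounded (Set.mem_univ _) (Set.mem_univ _)⟩

theorem modelDs_apply (hB : ∀ z ∈ B, z.swap ∈ B) (m : B → ℕ)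
    (hm : ∀ b, m (swapPoint hB b) = m b) (ξ : ModelSpace m) (b : B) (i : Fin (m b)) :
    modelDs hB m hm ξ b i = dist b.1.1 b.1.2 * ξ (swapPoint hB b) (Fin.cast (hm b).symm i) :=
  rfl

end Model

end

noncomputable section

open MeasureTheory Filter Topology

/-! ### Preliminaries: projector calculus and compact operators -/

namespace SpectralMeasure

variable {T : Type*} [MeasurableSpace T] {H : Type*}
    [NormedAddCommGroup H] [InnerProductSpace ℂ H] [CompleteSpace H]

/-! Injectivity and compactness of `ds` make each eigenspace `L_l` of `ds ^ 2` finite-dimensional.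
The reflection rule applied twice shows that every `P A` commutes with `ds ^ 2`, so `P` acts inside
`L_l`. Disjoint open sets around points of the support of `L_l` yield orthogonal nonzero vectors of
`L_l`, so that support is finite (`finite_eigenSupport`). Hence its points are atoms of `P` with
nonzero range (`fiber_ne_bot`), and these ranges, the fibers, make up `L_l`.

On the fiber over `z` a function acts as the scalar `f z` (`Represents.apply_eq_smul`), while `ds`
maps it to the fiber over `z.swap` and `ds ^ 2` is the squared distance. So `ds` divided by the
distance is an isometry between the two fibers. Distinct fibers are orthogonal, and together they
are total because eigenvectors of `ds` are (`eq_zero_of_forall_inner_fiber`).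

The distance is positive on the support, so `z` and `z.swap` differ. An orthonormal basis chosen
over one point of each pair and carried to the other by `ds` (`exists_adapted_frame`) gives the
coordinates that define `U`. Local finiteness of the support is compactness of `ds` tested on unit
vectors, one from each fiber. -/

theorem proj_proj_self (P : SpectralMeasure T H) {A : Set T} (hA : MeasurableSet A) (v : H) :
    P.proj A (P.proj A v) = P.proj A v :=
  congrArg (fun S : H →L[ℂ] H => S v) (P.isStarProjection_proj A hA).isIdempotentElem

theorem inner_proj_left (P : SpectralMeasure T H) {A : Set T} (hA : MeasurableSet A) (v w : H) :
    inner ℂ (P.proj A v) w = inner ℂ v (P.proj A w) :=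
  (P.isStarProjection_proj A hA).isSelfAdjoint.isSymmetric v w

theorem scalar_eq (P : SpectralMeasure T H) {A : Set T} (hA : MeasurableSet A) (v : H) :
    P.scalar v A = ENNReal.ofReal (‖P.proj A v‖ ^ 2) := by
  rw [P.scalar_apply v A hA, ← P.proj_proj_self hA, ← P.inner_proj_left hA,
    P.proj_proj_self hA, inner_self_eq_norm_sq_to_K]
  norm_cast

theorem isFiniteMeasure_scalar (P : SpectralMeasure T H) (v : H) :
    IsFiniteMeasure (P.scalar v) :=
  ⟨by rw [P.scalar_eq MeasurableSet.univ]; exact ENNReal.ofReal_lt_top⟩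

theorem real_scalar (P : SpectralMeasure T H) {A : Set T} (hA : MeasurableSet A) (v : H) :
    (P.scalar v).real A = ‖P.proj A v‖ ^ 2 := by
  rw [Measure.real, P.scalar_eq hA, ENNReal.toReal_ofReal (by positivity)]

theorem scalar_eq_zero_iff (P : SpectralMeasure T H) {A : Set T} (hA : MeasurableSet A) (v : H) :
    P.scalar v A = 0 ↔ P.proj A v = 0 := by
  have := P.isFiniteMeasure_scalar v
  rw [← measureReal_eq_zero_iff, P.real_scalar hA]
  simp

theorem norm_proj_le (P : SpectralMeasure T H) {A : Set T} (hA : MeasurableSet A) (v : H) :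
    ‖P.proj A v‖ ≤ ‖v‖ := by
  have h := norm_inner_le_norm (𝕜 := ℂ) v (P.proj A v)
  rw [← P.proj_proj_self hA, ← P.inner_proj_left hA, P.proj_proj_self hA,
    inner_self_eq_norm_sq_to_K, norm_pow] at h
  simp only [Complex.coe_algebraMap, Complex.norm_real, norm_norm] at h
  by_contra! hlt
  nlinarith [norm_nonneg v]

theorem proj_eq_self_of_norm_le (P : SpectralMeasure T H) {A : Set T} (hA : MeasurableSet A)
    {v : H} (h : ‖v‖ ≤ ‖P.proj A v‖) : P.proj A v = v := by
  have h1 : ‖v‖ * ‖v‖ = ‖P.proj A v‖ * ‖P.proj A v‖ + ‖v - P.proj A v‖ * ‖v - P.proj A v‖ := by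
    rw [← norm_add_sq_eq_norm_sq_add_norm_sq_of_inner_eq_zero (𝕜 := ℂ), add_sub_cancel]
    rw [P.inner_proj_left hA, map_sub, P.proj_proj_self hA, sub_self, inner_zero_right]
  have h2 : ‖v - P.proj A v‖ = 0 := by
    nlinarith [norm_nonneg v, norm_nonneg (v - P.proj A v), norm_nonneg (P.proj A v)]
  exact (sub_eq_zero.mp (norm_eq_zero.mp h2)).symm

/-- The structure only provides additivity of the scalar measures. At `w = P C v` it reads `‖P (A ∪
C) w‖² = ‖P A w‖² + ‖w‖²`, and the left side is at most `‖w‖²`. -/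
theorem proj_proj_of_disjoint (P : SpectralMeasure T H) {A C : Set T} (hA : MeasurableSet A)
    (hC : MeasurableSet C) (h : Disjoint A C) (v : H) : P.proj A (P.proj C v) = 0 := by
  have := P.isFiniteMeasure_scalar (P.proj C v)
  have h1 := measureReal_union (μ := P.scalar (P.proj C v)) h hC
  rw [P.real_scalar (hA.union hC), P.real_scalar hA, P.real_scalar hC, P.proj_proj_self hC] at h1
  have h2 := P.norm_proj_le (hA.union hC) (P.proj C v)
  have h3 : ‖P.proj A (P.proj C v)‖ = 0 := by
    nlinarith [norm_nonneg (P.proj A (P.proj C v)), norm_nonneg (P.proj (A ∪ C) (P.proj C v))]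
  exact norm_eq_zero.mp h3

theorem proj_proj_of_subset (P : SpectralMeasure T H) {A C : Set T} (hA : MeasurableSet A)
    (hC : MeasurableSet C) (h : A ⊆ C) (v : H) : P.proj C (P.proj A v) = P.proj A v := by
  have := P.isFiniteMeasure_scalar (P.proj A v)
  refine P.proj_eq_self_of_norm_le hC ?_
  have h1 := measureReal_mono (μ := P.scalar (P.proj A v)) h
  rw [P.real_scalar hA, P.real_scalar hC, P.proj_proj_self hA] at h1
  exact le_of_sq_le_sq h1 (norm_nonneg _)

theorem mem_range_proj_iff (P : SpectralMeasure T H) {A : Set T} (hA : MeasurableSet A) {v : H} :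
    v ∈ LinearMap.range (P.proj A : H →ₗ[ℂ] H) ↔ P.proj A v = v := by
  constructor
  · rintro ⟨w, rfl⟩
    exact P.proj_proj_self hA w
  · exact fun h => ⟨v, h⟩

theorem inner_eq_zero_of_disjoint (P : SpectralMeasure T H) {A C : Set T} (hA : MeasurableSet A)
    (hC : MeasurableSet C) (h : Disjoint A C) {v w : H} (hv : P.proj A v = v)
    (hw : P.proj C w = w) : inner ℂ v w = 0 := by
  rw [← hv, P.inner_proj_left hA, ← hw, P.proj_proj_of_disjoint hA hC h, inner_zero_right]

section Represents

variable [TopologicalSpace T] {P : SpectralMeasure T H} {ρ : C(T, ℂ) →⋆ₐ[ℂ] (H →L[ℂ] H)}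

/-- Integrating the constant `1` gives the total mass. The structure alone does not force the
projector of the whole space to be the identity. -/
theorem Represents.real_scalar_univ (hP : P.Represents ρ) (v : H) :
    (P.scalar v).real Set.univ = ‖v‖ ^ 2 := by
  have h := hP 1 v
  rw [map_one, one_apply_eq_self, inner_self_eq_norm_sq_to_K] at h
  simp only [ContinuousMap.one_apply, integral_const, Complex.real_smul, mul_one] at h
  exact (Complex.ofReal_injective (by simpa using h)).symm

/-- A vector whose scalar measure vanishes off `A` is fixed by the projector of `A`. -/
theorem Represents.proj_eq_self (hP : P.Represents ρ) {A : Set T} (hA : MeasurableSet A) {v : H}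
    (h : P.scalar v Aᶜ = 0) : P.proj A v = v := by
  have := P.isFiniteMeasure_scalar v
  refine P.proj_eq_self_of_norm_le hA ?_
  have h1 := measureReal_add_measureReal_compl (μ := P.scalar v) hA
  rw [P.real_scalar hA, hP.real_scalar_univ, Measure.real, h, ENNReal.toReal_zero, add_zero] at h1
  exact le_of_sq_le_sq h1.ge (norm_nonneg _)

/-- On the range of the projector of a point, a representation acts by evaluation. -/
theorem Represents.apply_eq_smul [MeasurableSingletonClass T] (hP : P.Represents ρ) {z : T} {v : H}
    (hv : P.proj {z} v = v) (f : C(T, ℂ)) : ρ f v = f z • v := by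
  have hz := MeasurableSet.singleton z
  have h0 : ∀ᵐ x ∂(P.scalar v), x = z := by
    change P.scalar v {z}ᶜ = 0
    rw [P.scalar_eq_zero_iff hz.compl, ← hv]
    exact P.proj_proj_of_disjoint hz.compl hz disjoint_compl_left v
  -- The squared norm of `ρ g v` is the integral of `|f - f z|²` against a measure concentrated at
  -- `z`.
  let g : C(T, ℂ) := f - f z • (1 : C(T, ℂ))
  have h1 : inner ℂ (ρ g v) (ρ g v) = 0 := by
    rw [inner_rep_self, hP]
    refine integral_eq_zero_of_ae ?_
    filter_upwards [h0] with x hx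
    simp [g, hx]
  have h2 : ρ g v = ρ f v - f z • v := by
    simp only [g, map_sub, map_smul, map_one]
    rfl
  rw [inner_self_eq_zero, h2, sub_eq_zero] at h1
  exact h1

end Represents

end SpectralMeasure

/-- A compact operator which maps an orthonormal family to an orthogonal family stays bounded away
from zero on finitely many members only. -/
theorem IsCompactOperator.finite_setOf_le_norm {ι H : Type*} [NormedAddCommGroup H]
    [InnerProductSpace ℂ H] {S : H →L[ℂ] H} (hS : IsCompactOperator S) {e : ι → H}
    (he : ∀ i, ‖e i‖ ≤ 1) (ho : Pairwise fun i j => inner ℂ (S (e i)) (S (e j)) = 0)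
    {t : ℝ} (ht : 0 < t) : {i | t ≤ ‖S (e i)‖}.Finite := by
  by_contra hinf
  let u : ℕ → ι := fun n => (Set.Infinite.natEmbedding _ hinf n : ι)
  have hu : Function.Injective u :=
    Subtype.val_injective.comp (Set.Infinite.natEmbedding _ hinf).injective
  have hut : ∀ n, t ≤ ‖S (e (u n))‖ := fun n => (Set.Infinite.natEmbedding _ hinf n).2
  have hK := hS.isCompact_closure_image_closedBall (f := S.toLinearMap) 1
  obtain ⟨a, -, φ, hφ, hlim⟩ := hK.tendsto_subseq (x := fun n => S (e (u n)))
    fun n => subset_closure ⟨e (u n), by simpa using he (u n), rfl⟩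
  obtain ⟨N, hN⟩ := Metric.cauchySeq_iff.mp hlim.cauchySeq t ht
  have h1 := hN N le_rfl (N + 1) (by omega)
  have hne : u (φ N) ≠ u (φ (N + 1)) := fun h =>
    (hφ (Nat.lt_succ_self N)).ne (hu h)
  -- Orthogonal images of norm at least `t` are at distance at least `√2 * t`, against the Cauchy
  -- bound `t`.
  have h3 : ‖S (e (u (φ N))) - S (e (u (φ (N + 1))))‖ ^ 2 =
      ‖S (e (u (φ N)))‖ ^ 2 + ‖S (e (u (φ (N + 1))))‖ ^ 2 := by
    rw [norm_sub_sq (𝕜 := ℂ), ho hne]; simp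
  rw [dist_eq_norm] at h1
  simp only [Function.comp] at h1
  nlinarith [hut (φ N), norm_nonneg (S (e (u (φ (N + 1))))),
    norm_nonneg (S (e (u (φ N))) - S (e (u (φ (N + 1)))))]

theorem mem_sqEigenspace {H : Type*} [NormedAddCommGroup H] [InnerProductSpace ℂ H]
    {S : H →L[ℂ] H} {l : ℂ} {v : H} :
    v ∈ sqEigenspace S l ↔ S (S v) = l ^ 2 • v :=
  Module.End.mem_eigenspace_iff

/-! ### Eigenspaces of the square of the length operator -/

namespace SpectralGeometry

variable {X : Type*} [MetricSpace X] [CompactSpace X] [MeasurableSpace X] [BorelSpace X]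
  {H : Type*} [NormedAddCommGroup H] [InnerProductSpace ℂ H] [CompleteSpace H]
  (M : SpectralGeometry X H)

/-- The spectral measure of a spectral geometry. -/
abbrev spec : SpectralMeasure (X × X) H := spectralMeasure M.repExt

/-- The support of the eigenspace of `ds ^ 2` for the value `l ^ 2`. -/
def eigenSupport (l : ℂ) : Set (X × X) := (orthogonalOpen M.spec M.ds l)ᶜ

/-- The range of the spectral projector of a point. -/
def fiber (z : X × X) : Submodule ℂ H := LinearMap.range (M.spec.proj {z} : H →ₗ[ℂ] H)

variable {M} in
theorem mem_fiber {z : X × X} {v : H} : v ∈ M.fiber z ↔ M.spec.proj {z} v = v :=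
  M.spec.mem_range_proj_iff (MeasurableSet.singleton z)

variable {M} in
theorem mem_support {z : X × X} : z ∈ M.support ↔
    ∃ l, Module.End.HasEigenvalue (M.ds : H →ₗ[ℂ] H) l ∧ z ∈ M.eigenSupport l := by
  simp [support, eigenSupport, spec]

theorem isOpen_orthogonalOpen (l : ℂ) : IsOpen (orthogonalOpen M.spec M.ds l) :=
  isOpen_sUnion fun _ h => h.1

theorem measurableSet_orthogonalOpen (l : ℂ) : MeasurableSet (orthogonalOpen M.spec M.ds l) :=
  (M.isOpen_orthogonalOpen l).measurableSet

theorem ds_proj {A : Set (X × X)} (hA : MeasurableSet A) (v : H) :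
    M.ds (M.spec.proj A v) = M.spec.proj (Prod.swap '' A) (M.ds v) :=
  congrArg (fun S : H →L[ℂ] H => S v) (M.ds_comp_proj A hA)

/-- Two reflections cancel, so `P A` commutes with `ds ^ 2`. -/
theorem proj_mem_sqEigenspace {A : Set (X × X)} (hA : MeasurableSet A) {l : ℂ} {v : H}
    (hv : v ∈ sqEigenspace M.ds l) : M.spec.proj A v ∈ sqEigenspace M.ds l := by
  rw [mem_sqEigenspace] at hv ⊢
  have hA' : MeasurableSet (Prod.swap '' A) := by
    rw [Set.image_swap_eq_preimage_swap]; exact measurable_swap hA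
  rw [M.ds_proj hA, M.ds_proj hA', hv, Set.image_image]
  simp

theorem ds_mem_fiber {z : X × X} {v : H} (hv : v ∈ M.fiber z) : M.ds v ∈ M.fiber z.swap := by
  rw [mem_fiber] at hv ⊢
  conv_rhs => rw [← hv, M.ds_proj (MeasurableSet.singleton z), Set.image_singleton]

theorem isSymmetric_ds : (M.ds : H →ₗ[ℂ] H).IsSymmetric := M.ds_selfAdjoint.isSymmetric

theorem eigenvalue_ne_zero {l : ℂ} (hl : Module.End.HasEigenvalue (M.ds : H →ₗ[ℂ] H) l) :
    l ≠ 0 := by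
  rintro rfl
  obtain ⟨v, hv⟩ := hl.exists_hasEigenvector
  refine hv.2 (M.ds_injective ?_)
  simpa using hv.apply_eq_smul

/-- Eigenvalues of a self-adjoint operator are real; this turns `l ^ 2` into a squared distance. -/
theorem eigenvalue_sq {l : ℂ} (hl : Module.End.HasEigenvalue (M.ds : H →ₗ[ℂ] H) l) :
    l ^ 2 = (‖l‖ : ℂ) ^ 2 := by
  have h := Complex.mul_conj' l
  rwa [show (starRingEnd ℂ) l = l from M.isSymmetric_ds.conj_eigenvalue_eq_self hl, ← sq] at h

theorem finiteDimensional_sqEigenspace {l : ℂ}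
    (hl : Module.End.HasEigenvalue (M.ds : H →ₗ[ℂ] H) l) :
    FiniteDimensional ℂ (sqEigenspace M.ds l) :=
  ContinuousLinearMap.finite_dimensional_eigenspace (M.ds_compact.comp_clm M.ds) _
    (pow_ne_zero 2 (M.eigenvalue_ne_zero hl))

theorem mem_orthogonal_iff {l : ℂ} (hl : Module.End.HasEigenvalue (M.ds : H →ₗ[ℂ] H) l) {v : H} :
    v ∈ (sqEigenspace M.ds l)ᗮ ↔ M.spec.proj (orthogonalOpen M.spec M.ds l) v = v := by
  rw [M.proj_orthogonalOpen l hl, Submodule.starProjection_eq_self_iff]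

/-- The kernel of the projector onto `L_lᗮ` is `L_lᗮᗮ`, which is `L_l` because `L_l` is
finite-dimensional. -/
theorem mem_sqEigenspace_iff {l : ℂ} (hl : Module.End.HasEigenvalue (M.ds : H →ₗ[ℂ] H) l) {v : H} :
    v ∈ sqEigenspace M.ds l ↔ M.spec.proj (orthogonalOpen M.spec M.ds l) v = 0 := by
  have := M.finiteDimensional_sqEigenspace hl
  rw [M.proj_orthogonalOpen l hl, Submodule.starProjection_apply_eq_zero_iff,
    Submodule.orthogonal_orthogonal]

/-! ### Finite supports and their atoms -/

theorem exists_proj_ne_zero {l : ℂ} {z : X × X} (hz : z ∈ M.eigenSupport l) {U : Set (X × X)}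
    (hU : IsOpen U) (hzU : z ∈ U) :
    ∃ v ∈ sqEigenspace M.ds l, M.spec.proj U v ≠ 0 := by
  by_contra! h
  -- If `P U` killed `L_l`, its range would be orthogonal to `L_l` by self-adjointness, which places
  -- `U` inside `A_l`.
  refine hz ⟨U, ⟨hU, ?_⟩, hzU⟩
  rintro _ ⟨w, rfl⟩
  rw [Submodule.mem_orthogonal]
  intro u hu
  change inner ℂ u (M.spec.proj U w) = 0
  rw [← M.spec.inner_proj_left hU.measurableSet, h u hu, inner_zero_left]

/-- One point more than the dimension of `L_l`, separated by disjoint open sets, would give too many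
orthogonal nonzero vectors in `L_l`. -/
theorem finite_eigenSupport {l : ℂ} (hl : Module.End.HasEigenvalue (M.ds : H →ₗ[ℂ] H) l) :
    (M.eigenSupport l).Finite := by
  have := M.finiteDimensional_sqEigenspace hl
  by_contra hinf
  obtain ⟨s, hs, hcard⟩ := Set.Infinite.exists_subset_card_eq hinf
    (Module.finrank ℂ (sqEigenspace M.ds l) + 1)
  obtain ⟨U, hU, hd⟩ := s.finite_toSet.t2_separation
  choose! v hv hne using fun z (hz : z ∈ s) =>
    M.exists_proj_ne_zero (hs hz) (hU z).2 (hU z).1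
  let w : s → sqEigenspace M.ds l := fun z =>
    ⟨M.spec.proj (U z) (v z), M.proj_mem_sqEigenspace (hU z).2.measurableSet (hv z z.2)⟩
  have hw : LinearIndependent ℂ w := by
    refine linearIndependent_of_ne_zero_of_inner_eq_zero (fun z h => ?_) fun z z' hzz => ?_
    · exact hne z z.2 (congrArg Subtype.val h)
    · exact M.spec.inner_eq_zero_of_disjoint (hU z).2.measurableSet (hU z').2.measurableSet
        (hd z.2 z'.2 (Subtype.coe_ne_coe.mpr hzz))
        (M.spec.proj_proj_self (hU z).2.measurableSet _)
        (M.spec.proj_proj_self (hU z').2.measurableSet _)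
  have := hw.fintype_card_le_finrank
  rw [Fintype.card_coe, hcard] at this
  omega

theorem fiber_le_sqEigenspace {l : ℂ} (hl : Module.End.HasEigenvalue (M.ds : H →ₗ[ℂ] H) l)
    {z : X × X} (hz : z ∈ M.eigenSupport l) : M.fiber z ≤ sqEigenspace M.ds l := by
  intro v hv
  rw [mem_fiber] at hv
  rw [M.mem_sqEigenspace_iff hl, ← hv]
  exact M.spec.proj_proj_of_disjoint (M.measurableSet_orthogonalOpen l)
    (MeasurableSet.singleton z) (Set.disjoint_singleton_right.mpr hz) v

/-- A point with zero fiber could be dropped from the support: adding it to `A_l` enlarges neither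
the range of the projector nor, since the support is finite, destroys openness. This contradicts the
maximality of `A_l`. -/
theorem fiber_ne_bot {l : ℂ} (hl : Module.End.HasEigenvalue (M.ds : H →ₗ[ℂ] H) l)
    {z : X × X} (hz : z ∈ M.eigenSupport l) : M.fiber z ≠ ⊥ := by
  intro hbot
  have hsing := MeasurableSet.singleton z
  -- This is `A_l ∪ {z}`.
  let U : Set (X × X) := (M.eigenSupport l \ {z})ᶜ
  have hU : IsOpen U := ((M.finite_eigenSupport hl).subset Set.sdiff_subset).isClosed.isOpen_compl
  refine hz ⟨U, ⟨hU, ?_⟩, fun h => h.2 rfl⟩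
  rintro w hw
  rw [M.spec.mem_range_proj_iff hU.measurableSet] at hw
  rw [M.mem_orthogonal_iff hl]
  refine (spectralMeasure_represents M.repExt).proj_eq_self (M.measurableSet_orthogonalOpen l) ?_
  have h1 : M.spec.scalar w {z} = 0 := by
    rw [M.spec.scalar_eq_zero_iff hsing, ← Submodule.mem_bot (R := ℂ), ← hbot]
    exact ⟨w, rfl⟩
  have h2 : M.spec.scalar w Uᶜ = 0 := by
    rw [M.spec.scalar_eq_zero_iff hU.measurableSet.compl, ← hw]
    exact M.spec.proj_proj_of_disjoint hU.measurableSet.compl hU.measurableSet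
      disjoint_compl_left w
  refine measure_mono_null ?_ (measure_union_null h1 h2)
  intro y hy
  by_cases hyz : y = z
  · exact Or.inl hyz
  · exact Or.inr (by rw [compl_compl]; exact ⟨hy, hyz⟩)

/-- A nonzero fiber vector is sent by `ds` to a nonzero vector of `L_l` in the fiber over `z.swap`.
If `z.swap` were in `A_l`, the projector of `A_l` would both fix and kill it. -/
theorem swap_mem_eigenSupport {l : ℂ} (hl : Module.End.HasEigenvalue (M.ds : H →ₗ[ℂ] H) l)
    {z : X × X} (hz : z ∈ M.eigenSupport l) : z.swap ∈ M.eigenSupport l := by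
  intro hmem
  obtain ⟨v, hv, hne⟩ := Submodule.exists_mem_ne_zero_of_ne_bot (M.fiber_ne_bot hl hz)
  have h1 := mem_fiber.mp (M.ds_mem_fiber hv)
  have h2 : M.ds v ∈ sqEigenspace M.ds l := by
    have := mem_sqEigenspace.mp (M.fiber_le_sqEigenspace hl hz hv)
    rw [mem_sqEigenspace, this, map_smul]
  rw [M.mem_sqEigenspace_iff hl, ← h1, M.spec.proj_proj_of_subset (MeasurableSet.singleton _)
    (M.measurableSet_orthogonalOpen l) (Set.singleton_subset_iff.mpr hmem), h1] at h2
  exact hne (M.ds_injective (h2.trans (map_zero _).symm))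

theorem dist_of_mem_eigenSupport {l : ℂ} (hl : Module.End.HasEigenvalue (M.ds : H →ₗ[ℂ] H) l)
    {z : X × X} (hz : z ∈ M.eigenSupport l) : dist z.1 z.2 = ‖l‖ :=
  M.dist_eq l hl z hz

/-! ### The whole support: symmetry, discreteness and totality of the fibers -/

theorem swap_mem_support {z : X × X} (hz : z ∈ M.support) : z.swap ∈ M.support := by
  obtain ⟨l, hl, hzl⟩ := mem_support.mp hz
  exact mem_support.mpr ⟨l, hl, M.swap_mem_eigenSupport hl hzl⟩

theorem dist_pos_of_mem_support {z : X × X} (hz : z ∈ M.support) : 0 < dist z.1 z.2 := by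
  obtain ⟨l, hl, hzl⟩ := mem_support.mp hz
  rw [M.dist_of_mem_eigenSupport hl hzl]
  exact norm_pos_iff.mpr (M.eigenvalue_ne_zero hl)

theorem ds_ds_of_mem_fiber {z : X × X} (hz : z ∈ M.support) {v : H} (hv : v ∈ M.fiber z) :
    M.ds (M.ds v) = (dist z.1 z.2 : ℂ) ^ 2 • v := by
  obtain ⟨l, hl, hzl⟩ := mem_support.mp hz
  rw [M.dist_of_mem_eigenSupport hl hzl, ← M.eigenvalue_sq hl]
  exact mem_sqEigenspace.mp (M.fiber_le_sqEigenspace hl hzl hv)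

/-- This makes `ds` a similarity on the fiber, with the distance as its ratio. -/
theorem inner_ds_ds_of_mem_fiber {z : X × X} (hz : z ∈ M.support) (u : H) {v : H}
    (hv : v ∈ M.fiber z) :
    inner ℂ (M.ds u) (M.ds v) = (dist z.1 z.2 : ℂ) ^ 2 * inner ℂ u v := by
  have h := M.isSymmetric_ds u (M.ds v)
  simp only [ContinuousLinearMap.coe_coe] at h
  rw [h, M.ds_ds_of_mem_fiber hz hv, inner_smul_right]

theorem norm_ds_of_mem_fiber {z : X × X} (hz : z ∈ M.support) {v : H} (hv : v ∈ M.fiber z) :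
    ‖M.ds v‖ = dist z.1 z.2 * ‖v‖ := by
  have h := M.inner_ds_ds_of_mem_fiber hz v hv
  rw [inner_self_eq_norm_sq_to_K, inner_self_eq_norm_sq_to_K, ← mul_pow] at h
  simp only [Complex.coe_algebraMap] at h
  refine (pow_left_inj₀ (norm_nonneg _) (by positivity) two_ne_zero).mp ?_
  exact_mod_cast h

theorem finiteDimensional_fiber {z : X × X} (hz : z ∈ M.support) :
    FiniteDimensional ℂ (M.fiber z) := by
  obtain ⟨l, hl, hzl⟩ := mem_support.mp hz
  have := M.finiteDimensional_sqEigenspace hl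
  exact Submodule.finiteDimensional_of_le (M.fiber_le_sqEigenspace hl hzl)

theorem fiber_ne_bot_of_mem_support {z : X × X} (hz : z ∈ M.support) : M.fiber z ≠ ⊥ := by
  obtain ⟨l, hl, hzl⟩ := mem_support.mp hz
  exact M.fiber_ne_bot hl hzl

theorem inner_eq_zero_of_mem_fiber {z z' : X × X} (h : z ≠ z') {v w : H} (hv : v ∈ M.fiber z)
    (hw : w ∈ M.fiber z') : inner ℂ v w = 0 :=
  M.spec.inner_eq_zero_of_disjoint (MeasurableSet.singleton z) (MeasurableSet.singleton z')
    (Set.disjoint_singleton.mpr h) (mem_fiber.mp hv) (mem_fiber.mp hw)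

theorem repExt_of_mem_fiber {z : X × X} {v : H} (hv : v ∈ M.fiber z) (f : C(X × X, ℂ)) :
    M.repExt f v = f z • v :=
  (spectralMeasure_represents M.repExt).apply_eq_smul (mem_fiber.mp hv) f

/-- Unit vectors, one per fiber, go to vectors in the reflected fibers: pairwise orthogonal, with
norms equal to the distances. Compactness leaves finitely many of norm at least `t`. -/
theorem finite_support_le_dist {t : ℝ} (ht : 0 < t) :
    {z ∈ M.support | t ≤ dist z.1 z.2}.Finite := by
  choose! f hf hne using fun z (hz : z ∈ M.support) =>
    Submodule.exists_mem_ne_zero_of_ne_bot (M.fiber_ne_bot_of_mem_support hz)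
  let e : M.support → H := fun z => ((‖f z‖ : ℂ)⁻¹) • f z
  have he : ∀ z : M.support, e z ∈ M.fiber z := fun z => Submodule.smul_mem _ _ (hf z z.2)
  have hn : ∀ z, ‖e z‖ = 1 := fun z => norm_smul_inv_norm (hne z z.2)
  have h := M.ds_compact.finite_setOf_le_norm (S := M.ds) (e := e) (fun z => (hn z).le)
    (fun z z' hzz => M.inner_eq_zero_of_mem_fiber
      (fun h => hzz (Subtype.ext (Prod.swap_injective h)))
      (M.ds_mem_fiber (he z)) (M.ds_mem_fiber (he z'))) ht
  refine (h.image Subtype.val).subset ?_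
  rintro z ⟨hz, hzt⟩
  refine ⟨⟨z, hz⟩, ?_, rfl⟩
  change t ≤ ‖M.ds (e ⟨z, hz⟩)‖
  rwa [M.norm_ds_of_mem_fiber hz (he ⟨z, hz⟩), hn, mul_one]

/-- A vector orthogonal to all fibers has a scalar measure vanishing at each point of a finite
support, so it lies in the range of `P A_l`, that is in `L_lᗮ`. It is then orthogonal to all
eigenvectors of `ds`, which are total by the spectral theorem for compact operators. -/
theorem eq_zero_of_forall_inner_fiber {v : H}
    (h : ∀ z ∈ M.support, ∀ w ∈ M.fiber z, inner ℂ w v = 0) : v = 0 := by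
  rw [← Submodule.mem_bot (R := ℂ), ← ContinuousLinearMap.orthogonalComplement_iSup_eigenspaces_eq_bot
    M.ds_compact M.isSymmetric_ds, Submodule.mem_orthogonal']
  intro u hu
  rw [← Submodule.mem_orthogonal_singleton_iff_inner_right]
  revert u
  change (⨆ μ, Module.End.eigenspace (M.ds : H →ₗ[ℂ] H) μ) ≤ (ℂ ∙ v)ᗮ
  refine iSup_le fun l u hu => ?_
  rw [Submodule.mem_orthogonal_singleton_iff_inner_right]
  by_cases hl : Module.End.HasEigenvalue (M.ds : H →ₗ[ℂ] H) l
  · have hu' : u ∈ sqEigenspace M.ds l := by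
      have h1 : M.ds u = l • u := Module.End.mem_eigenspace_iff.mp hu
      rw [mem_sqEigenspace, h1, map_smul, h1, smul_smul, sq]
    refine inner_eq_zero_symm.mp ((Submodule.mem_orthogonal _ v).mp ?_ u hu')
    rw [M.mem_orthogonal_iff hl]
    refine (spectralMeasure_represents M.repExt).proj_eq_self (M.measurableSet_orthogonalOpen l) ?_
    change M.spec.scalar v (M.eigenSupport l) = 0
    rw [← Set.biUnion_of_singleton (M.eigenSupport l),
      measure_biUnion_null_iff (M.finite_eigenSupport hl).countable]
    intro z hz
    rw [M.spec.scalar_eq_zero_iff (MeasurableSet.singleton z), ← inner_self_eq_zero (𝕜 := ℂ),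
      ← M.spec.inner_proj_left (MeasurableSet.singleton z),
      M.spec.proj_proj_self (MeasurableSet.singleton z)]
    exact h z (mem_support.mpr ⟨l, hl, hz⟩) _ ⟨v, rfl⟩
  · rw [Module.End.hasEigenvalue_iff, not_not] at hl
    rw [hl, Submodule.mem_bot] at hu
    rw [hu, inner_zero_right]

end SpectralGeometry

/-! ### Adapted frames and the isometry onto the model -/

namespace SpectralGeometry

variable {X : Type*} [MetricSpace X] [CompactSpace X] [MeasurableSpace X] [BorelSpace X]
  {H : Type*} [NormedAddCommGroup H] [InnerProductSpace ℂ H] [CompleteSpace H]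
  (M : SpectralGeometry X H)

/-- The multiplicity of a point: the dimension of its fibre. -/
def mult (z : X × X) : ℕ := Module.finrank ℂ (M.fiber z)

theorem mult_pos {z : X × X} (hz : z ∈ M.support) : 0 < M.mult z := by
  have := M.finiteDimensional_fiber hz
  have := Submodule.nontrivial_iff_ne_bot.mpr (M.fiber_ne_bot_of_mem_support hz)
  exact Module.finrank_pos

/-- `ds` embeds each fiber into the reflected one. -/
theorem mult_le_mult_swap {z : X × X} (hz : z ∈ M.support) : M.mult z ≤ M.mult z.swap := by
  have := M.finiteDimensional_fiber hz
  have := M.finiteDimensional_fiber (M.swap_mem_support hz)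
  refine LinearMap.finrank_le_finrank_of_injective
    (f := (M.ds : H →ₗ[ℂ] H).restrict fun v hv => M.ds_mem_fiber hv) fun v w h => ?_
  exact Subtype.ext (M.ds_injective (congrArg Subtype.val h))

theorem mult_swap {z : X × X} (hz : z ∈ M.support) : M.mult z.swap = M.mult z :=
  le_antisymm (M.mult_le_mult_swap (M.swap_mem_support hz)) (M.mult_le_mult_swap hz)

theorem exists_orthonormal_fiber {z : X × X} (hz : z ∈ M.support) :
    ∃ f : ℕ → H, (∀ k, f k ∈ M.fiber z) ∧ Orthonormal ℂ fun k : Fin (M.mult z) => f k := by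
  have := M.finiteDimensional_fiber hz
  let b : OrthonormalBasis (Fin (M.mult z)) ℂ (M.fiber z) := stdOrthonormalBasis ℂ (M.fiber z)
  -- Indexing by `ℕ`, with value `0` beyond the multiplicity, lets the bases over `z` and `z.swap`
  -- share indices without casts.
  refine ⟨fun k => if h : k < M.mult z then (b ⟨k, h⟩ : H) else 0, fun k => ?_, ?_⟩
  · by_cases h : k < M.mult z
    · simp [h]
    · simp [h]
  · convert b.orthonormal.comp_linearIsometry (M.fiber z).subtypeₗᵢ using 1
    funext k
    simp

/-- The fibres have orthonormal bases which `ds` interchanges up to the distance factor. -/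
theorem exists_adapted_frame :
    ∃ e : X × X → ℕ → H, ∀ z ∈ M.support, (∀ k, e z k ∈ M.fiber z) ∧
      (Orthonormal ℂ fun k : Fin (M.mult z) => e z k) ∧
      ∀ k, M.ds (e z k) = (dist z.1 z.2 : ℂ) • e z.swap k := by
  classical
  choose! f hf hon using fun z (hz : z ∈ M.support) => M.exists_orthonormal_fiber hz
  -- A well-ordering of `X` selects one point of each pair `z`, `z.swap`; the two differ because the
  -- support misses the diagonal.
  let r : X × X → Prop := fun z => WellOrderingRel z.1 z.2
  have hr : ∀ z ∈ M.support, r z.swap ↔ ¬ r z := by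
    intro z hz
    have hne : z.1 ≠ z.2 := dist_pos.mp (M.dist_pos_of_mem_support hz)
    constructor
    · exact fun h h' => asymm_of WellOrderingRel h h'
    · intro h
      rcases trichotomous_of WellOrderingRel z.1 z.2 with h1 | h1 | h1
      exacts [absurd h1 h, absurd h1 hne, h1]
  -- The chosen basis is kept over selected points and transported by the normalized `ds` over the
  -- others.
  let e : X × X → ℕ → H := fun z k =>
    if r z then f z k else (dist z.1 z.2 : ℂ)⁻¹ • M.ds (f z.swap k)
  refine ⟨e, fun z hz => ?_⟩
  have hs := M.swap_mem_support hz
  have hd : (dist z.1 z.2 : ℂ) ≠ 0 :=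
    Complex.ofReal_ne_zero.mpr (M.dist_pos_of_mem_support hz).ne'
  by_cases h : r z
  · have hez : e z = f z := by funext k; simp [e, h]
    have hes : e z.swap = fun k => (dist z.1 z.2 : ℂ)⁻¹ • M.ds (f z k) := by
      funext k
      simp only [e, if_neg (fun h' => (hr z hz).mp h' h), Prod.swap_swap, Prod.fst_swap,
        Prod.snd_swap, dist_comm z.2]
    rw [hez, hes]
    exact ⟨hf z hz, hon z hz, fun k => (smul_inv_smul₀ hd _).symm⟩
  · have hez : e z = fun k => (dist z.1 z.2 : ℂ)⁻¹ • M.ds (f z.swap k) := by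
      funext k; simp [e, h]
    have hes : e z.swap = f z.swap := by funext k; simp [e, (hr z hz).mpr h]
    have hdist : dist z.swap.1 z.swap.2 = dist z.1 z.2 := dist_comm _ _
    rw [hez, hes]
    refine ⟨fun k => Submodule.smul_mem _ _ ?_, ?_, fun k => ?_⟩
    · simpa using M.ds_mem_fiber (hf _ hs k)
    · have ho := orthonormal_iff_ite.mp (hon _ hs)
      rw [orthonormal_iff_ite]
      intro i j
      have hij := ho (Fin.cast (M.mult_swap hz).symm i) (Fin.cast (M.mult_swap hz).symm j)
      simp only [Fin.val_cast, Fin.cast_inj] at hij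
      rw [inner_smul_left, inner_smul_right, M.inner_ds_ds_of_mem_fiber hs _ (hf _ hs j), hij,
        hdist, map_inv₀, Complex.conj_ofReal]
      field_simp
    · rw [map_smul, M.ds_ds_of_mem_fiber hs (hf _ hs k), hdist, smul_smul, sq, inv_mul_cancel_left₀ hd]

/-- An orthonormal basis of a fibre identifies it with a Euclidean space. -/
theorem exists_fiber_isometry {z : X × X} (hz : z ∈ M.support) {e : Fin (M.mult z) → H}
    (he : ∀ k, e k ∈ M.fiber z) (ho : Orthonormal ℂ e) :
    ∃ V : EuclideanSpace ℂ (Fin (M.mult z)) →ₗᵢ[ℂ] H,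
      LinearMap.range V.toLinearMap = M.fiber z ∧ ∀ k, V (EuclideanSpace.single k 1) = e k := by
  have := M.finiteDimensional_fiber hz
  have hon : Orthonormal ℂ fun k => (⟨e k, he k⟩ : M.fiber z) :=
    (M.fiber z).subtypeₗᵢ.orthonormal_comp_iff.mp ho
  let b : OrthonormalBasis (Fin (M.mult z)) ℂ (M.fiber z) := OrthonormalBasis.mk hon
    (hon.linearIndependent.span_eq_top_of_card_eq_finrank' (Fintype.card_fin _)).ge
  refine ⟨(M.fiber z).subtypeₗᵢ.comp b.repr.symm.toLinearIsometry, ?_, fun k => ?_⟩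
  · ext v
    constructor
    · rintro ⟨x, rfl⟩
      exact (b.repr.symm x).2
    · intro hv
      exact ⟨b.repr ⟨v, hv⟩, by simp⟩
  · simp [b]

/-- The Hilbert space of a spectral geometry is the model space over its support, with coordinates
taken along the vectors of an adapted frame. -/
theorem exists_isometry_modelSpace :
    ∃ (U : H ≃ₗᵢ[ℂ] ModelSpace fun b : M.support => M.mult b) (e : X × X → ℕ → H),
      (∀ z ∈ M.support, ∀ k, e z k ∈ M.fiber z ∧
        M.ds (e z k) = (dist z.1 z.2 : ℂ) • e z.swap k) ∧
      ∀ (ξ : H) (b : M.support) (i : Fin (M.mult b)), U ξ b i = inner ℂ (e b i) ξ := by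
  classical
  obtain ⟨e, he⟩ := M.exists_adapted_frame
  choose V hVr hVe using fun b : M.support =>
    M.exists_fiber_isometry b.2 (fun k => (he b b.2).1 k) (he b b.2).2.1
  have hmem : ∀ (b : M.support) x, V b x ∈ M.fiber b := fun b x => by
    rw [← hVr b]; exact ⟨x, rfl⟩
  have hsum : IsHilbertSum ℂ (fun b : M.support => EuclideanSpace ℂ (Fin (M.mult b))) V := by
    refine IsHilbertSum.mk (fun b c hbc x y => ?_) ?_
    · exact M.inner_eq_zero_of_mem_fiber (Subtype.coe_ne_coe.mpr hbc) (hmem b x) (hmem c y)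
    · rw [top_le_iff, Submodule.topologicalClosure_eq_top_iff, Submodule.eq_bot_iff]
      intro v hv
      refine M.eq_zero_of_forall_inner_fiber fun z hz w hw => ?_
      refine (Submodule.mem_orthogonal _ v).mp hv w ?_
      refine Submodule.mem_iSup_of_mem ⟨z, hz⟩ ?_
      rwa [hVr]
  refine ⟨hsum.linearIsometryEquiv, e, fun z hz k => ⟨(he z hz).1 k, (he z hz).2.2 k⟩,
    fun ξ b i => ?_⟩
  -- The frame vector is the preimage of a coordinate vector, so pairing with it reads off that
  -- coordinate.
  rw [← hVe b i, ← hsum.linearIsometryEquiv_symm_apply_single, ← LinearIsometryEquiv.inner_map_map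
    hsum.linearIsometryEquiv, LinearIsometryEquiv.apply_symm_apply, lp.inner_single_left,
    EuclideanSpace.inner_single_left, map_one, one_mul]

end SpectralGeometry

end

theorem mainTheorem1 {X : Type*} [MetricSpace X] [CompactSpace X] [MeasurableSpace X]
    [BorelSpace X] {H : Type*} [NormedAddCommGroup H] [InnerProductSpace ℂ H] [CompleteSpace H]
    (M : SpectralGeometry X H) :
    M.support ⊆ (Set.diagonal X)ᶜ ∧
    (∀ t : ℝ, 0 < t → {z ∈ M.support | t ≤ dist z.1 z.2}.Finite) ∧
    ∃ hB : ∀ z ∈ M.support, z.swap ∈ M.support,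
      ∃ (m : M.support → ℕ) (hm : ∀ b, m (swapPoint hB b) = m b),
        (∀ b, 0 < m b) ∧
        ∃ U : H ≃ₗᵢ[ℂ] ModelSpace m,
          (∀ (a : lipschitzAlgebra X) (ξ : H), U (M.rep a ξ) = modelRep m a (U ξ)) ∧
          ∀ ξ : H, U (M.ds ξ) = modelDs hB m hm (U ξ) := by
  obtain ⟨U, e, he, hU⟩ := M.exists_isometry_modelSpace
  refine ⟨fun z hz => dist_pos.mp (M.dist_pos_of_mem_support hz),
    fun t ht => M.finite_support_le_dist ht, fun z hz => M.swap_mem_support hz,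
    fun b => M.mult b, fun b => M.mult_swap b.2, fun b => M.mult_pos b.2, U, ?_, ?_⟩
  · intro a ξ
    ext b i
    change _ = modelMul _ (a : C(X, ℂ)) (U ξ) b i
    -- The adjoint moves the operator onto the frame vector, where it acts by the conjugate of `a`
    -- at the first component; the inner product conjugates it back.
    rw [modelMul_apply, PiLp.smul_apply, hU, hU, M.rep_eq,
      ← ContinuousLinearMap.adjoint_inner_left, ← ContinuousLinearMap.star_eq_adjoint, ← map_star,
      M.repExt_of_mem_fiber (he b b.2 i).1, inner_smul_left]
    simp [liftFst]
  · intro ξ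
    ext b i
    have h := M.isSymmetric_ds (e b i) ξ
    simp only [ContinuousLinearMap.coe_coe] at h
    rw [(he b b.2 i).2, inner_smul_left, Complex.conj_ofReal] at h
    let hB : ∀ z ∈ M.support, z.swap ∈ M.support := fun z hz => M.swap_mem_support hz
    -- `Fin.cast` keeps the natural number `i`, so this coordinate pairs `ξ` with the same frame
    -- vector `e z.swap i` that appears in `h`.
    have hs := hU ξ (swapPoint hB b) (Fin.cast (M.mult_swap b.2).symm i)
    have hd := modelDs_apply hB (fun b => M.mult b) (fun b => M.mult_swap b.2) (U ξ) b i
    exact (hU _ b i).trans (h.symm.trans ((congrArg _ hs.symm).trans hd.symm))
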